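/- Let $\mathbf A$ be a pointed homotopical category, that is, a category equipped with the following structure. (i) Homotopies $\alpha: f\simeq g: X\to Y$ between parallel maps, with whiskering $v.\alpha.u$ by maps (strictly associative and unital), trivial homotopies $0_f: f\simeq f$, reversed homotopies $-\alpha: g\simeq f$ and concatenations $\alpha+\beta$, all strictly preserved by whiskering; and an equivalence relation $\simeq_2$ (2-homotopy) between parallel homotopies, compatible with all these operations, up to which concatenation satisfies the laws of a groupoid and the reduced interchange law $h\alpha+\beta g\simeq_2\beta f+k\alpha$ holds (for $\alpha:f\simeq g:X\to Y$ and $\beta:h\simeq k:Y\to Z$). (ii) A zero object $0$ such that every homotopy between maps into $0$, or between maps out of $0$, is trivial. (iii) For each map $f:A\to B$ an h-kernel $(Kf,\ kf: Kf\to A,\ \kappa f: 0\simeq f.kf)$, with two universal properties: for all $x:X\to A$ and $\xi:0\simeq f.x$ there is a unique $t:X\to Kf$ with $kf.t=x$ and $\kappa f.t=\xi$; and for all $a,b:X\to Kf$ and $\theta: kf.a\simeq kf.b$ with $\kappa f.a+f\theta\simeq_2\kappa f.b$ there is some $\varphi:a\simeq b$ with $kf.\varphi=\theta$. Dually, for each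 map $f:A\to B$ an h-cokernel $(Cf,\ cf:B\to Cf,\ \gamma f:0\simeq cf.f)$: for all $y:B\to Y$ and $\xi:0\simeq y.f$ there is a unique $t:Cf\to Y$ with $t.cf=y$ and $t.\gamma f=\xi$; and for all $a,b:Cf\to Y$ and $\theta:a.cf\simeq b.cf$ with $a.\gamma f+\theta f\simeq_2 b.\gamma f$ there is some $\varphi:a\simeq b$ with $\varphi.cf=\theta$. A map $f:X\to Y$ is a homotopy equivalence if there is a map $g:Y\to X$ with $gf\simeq 1_X$ and $fg\simeq 1_Y$. An h-differential sequence $(f,g;\alpha)$ consists of maps $f:X\to A$, $g:A\to Y$ and a nullhomotopy $\alpha:0\simeq gf$. Let $u_\alpha:X\to Kg$ be determined by $kg.u_\alpha=f$, $\kappa g.u_\alpha=\alpha$; let $v_\alpha:Cf\to Y$ be determined by $v_\alpha.cf=g$, $v_\alpha.\gamma f=\alpha$; let $u:K(cf)\to Kg$ be determined by $kg.u=k(cf)$, $\kappa g.u=v_\alpha.\kappa(cf)$; and let $v:Cf\to C(kg)$ be determined by $v.cf=c(kg)$, $v.\gamma f=\gamma(kg).u_\alpha$. The sequence is *left h-exact*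 if $u_\alpha$ is a homotopy equivalence, *right h-exact* if $v_\alpha$ is one, *strongly h-exact* if it is both left and right h-exact, and *h-exact* if $u$ and $v$ are homotopy equivalences. A sequence $(f,g;\alpha)$, with $f:A'\to A$ and $g:A\to A''$, is (coherently) *equivalent* to $(x,y;\beta)$, with $x:B'\to B$ and $y:B\to B''$, if there are homotopy equivalences $u':A'\to B'$, $u:A\to B$, $u'':A''\to B''$ and homotopies $\varphi:uf\simeq xu'$, $\psi:u''g\simeq yu$ such that $$\beta u'-y\varphi\ \simeq_2\ u''\alpha+\psi f.$$ Then: 1. If $(f,g;\alpha)$ is equivalent to $(x,y;\beta)$, each of the properties left h-exact, right h-exact, strongly h-exact and h-exact holds for $(f,g;\alpha)$ if and only if it holds for $(x,y;\beta)$. 2. An h-differential sequence $(f,g;\alpha)$ is left h-exact if and only if it is equivalent to $(kg,g;\kappa g)$. -/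

import Mathlib

open CategoryTheory CategoryTheory.Limits

universe w v u

/-- A category with homotopies, reversible and composable up to 2-homotopy ("lax 2-category"):
`Htpy X Y` is the collection of all homotopies between maps `X ⟶ Y`; a homotopy `α` goes from the
map `src α` to the map `tgt α`, that is `α : src α ≃ tgt α`.  Homotopies can be whiskered with
maps, `pre u α = α.u` and `post α v = v.α`, strictly associatively; there are trivial homotopies
`triv f = 0_f`, reversed homotopies `rev α = -α` and concatenations `concat α β = α + β`, all
respected by whiskering; the vertical structure is groupoidal, and the reduced interchange holds,
only up to the equivalence relation `Rel₂` (2-homotopy) between parallel homotopies. -/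
class HomotopyStructure (C : Type u) [Category.{v} C] where
  /-- homotopies between maps from `X` to `Y` -/
  Htpy : C → C → Type w
  src : ∀ {X Y : C}, Htpy X Y → (X ⟶ Y)
  tgt : ∀ {X Y : C}, Htpy X Y → (X ⟶ Y)
  -- whisker composition
  pre : ∀ {W X Y : C}, (W ⟶ X) → Htpy X Y → Htpy W Y
  post : ∀ {X Y Z : C}, Htpy X Y → (Y ⟶ Z) → Htpy X Z
  src_pre : ∀ {W X Y : C} (p : W ⟶ X) (α : Htpy X Y), src (pre p α) = p ≫ src α
  tgt_pre : ∀ {W X Y : C} (p : W ⟶ X) (α : Htpy X Y), tgt (pre p α) = p ≫ tgt α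
  src_post : ∀ {X Y Z : C} (α : Htpy X Y) (q : Y ⟶ Z), src (post α q) = src α ≫ q
  tgt_post : ∀ {X Y Z : C} (α : Htpy X Y) (q : Y ⟶ Z), tgt (post α q) = tgt α ≫ q
  pre_id : ∀ {X Y : C} (α : Htpy X Y), pre (𝟙 X) α = α
  post_id : ∀ {X Y : C} (α : Htpy X Y), post α (𝟙 Y) = α
  pre_comp : ∀ {V W X Y : C} (p : V ⟶ W) (q : W ⟶ X) (α : Htpy X Y),
    pre (p ≫ q) α = pre p (pre q α)
  post_comp : ∀ {X Y Z T : C} (α : Htpy X Y) (p : Y ⟶ Z) (q : Z ⟶ T),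
    post α (p ≫ q) = post (post α p) q
  post_pre : ∀ {W X Y Z : C} (p : W ⟶ X) (α : Htpy X Y) (q : Y ⟶ Z),
    post (pre p α) q = pre p (post α q)
  -- trivial homotopies
  triv : ∀ {X Y : C}, (X ⟶ Y) → Htpy X Y
  src_triv : ∀ {X Y : C} (f : X ⟶ Y), src (triv f) = f
  tgt_triv : ∀ {X Y : C} (f : X ⟶ Y), tgt (triv f) = f
  pre_triv : ∀ {W X Y : C} (p : W ⟶ X) (f : X ⟶ Y), pre p (triv f) = triv (p ≫ f)
  post_triv : ∀ {X Y Z : C} (f : X ⟶ Y) (q : Y ⟶ Z), post (triv f) q = triv (f ≫ q)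
  -- reversed homotopies
  rev : ∀ {X Y : C}, Htpy X Y → Htpy X Y
  src_rev : ∀ {X Y : C} (α : Htpy X Y), src (rev α) = tgt α
  tgt_rev : ∀ {X Y : C} (α : Htpy X Y), tgt (rev α) = src α
  pre_rev : ∀ {W X Y : C} (p : W ⟶ X) (α : Htpy X Y), pre p (rev α) = rev (pre p α)
  post_rev : ∀ {X Y Z : C} (α : Htpy X Y) (q : Y ⟶ Z), post (rev α) q = rev (post α q)
  -- concatenation of consecutive homotopies
  concat : ∀ {X Y : C} (α β : Htpy X Y), tgt α = src β → Htpy X Y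
  src_concat : ∀ {X Y : C} (α β : Htpy X Y) (h : tgt α = src β), src (concat α β h) = src α
  tgt_concat : ∀ {X Y : C} (α β : Htpy X Y) (h : tgt α = src β), tgt (concat α β h) = tgt β
  pre_concat : ∀ {W X Y : C} (p : W ⟶ X) (α β : Htpy X Y) (h : tgt α = src β),
    pre p (concat α β h) = concat (pre p α) (pre p β) (by rw [tgt_pre, src_pre, h])
  post_concat : ∀ {X Y Z : C} (α β : Htpy X Y) (h : tgt α = src β) (q : Y ⟶ Z),
    post (concat α β h) q = concat (post α q) (post β q) (by rw [tgt_post, src_post, h])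
  -- 2-homotopy: an equivalence relation between parallel homotopies, compatible with the operations
  Rel₂ : ∀ {X Y : C}, Htpy X Y → Htpy X Y → Prop
  rel_src : ∀ {X Y : C} {α β : Htpy X Y}, Rel₂ α β → src α = src β
  rel_tgt : ∀ {X Y : C} {α β : Htpy X Y}, Rel₂ α β → tgt α = tgt β
  rel_equiv : ∀ X Y : C, Equivalence (Rel₂ (X := X) (Y := Y))
  rel_pre : ∀ {W X Y : C} (p : W ⟶ X) {α β : Htpy X Y}, Rel₂ α β → Rel₂ (pre p α) (pre p β)
  rel_post : ∀ {X Y Z : C} {α β : Htpy X Y} (q : Y ⟶ Z), Rel₂ α β → Rel₂ (post α q) (post β q)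
  rel_rev : ∀ {X Y : C} {α β : Htpy X Y}, Rel₂ α β → Rel₂ (rev α) (rev β)
  rel_concat : ∀ {X Y : C} {α α' β β' : Htpy X Y} (h : tgt α = src β) (h' : tgt α' = src β'),
    Rel₂ α α' → Rel₂ β β' → Rel₂ (concat α β h) (concat α' β' h')
  -- groupoid laws up to 2-homotopy
  triv_concat : ∀ {X Y : C} (α : Htpy X Y), Rel₂ (concat (triv (src α)) α (tgt_triv _)) α
  concat_triv : ∀ {X Y : C} (α : Htpy X Y), Rel₂ (concat α (triv (tgt α)) (src_triv _).symm) α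
  concat_rev : ∀ {X Y : C} (α : Htpy X Y),
    Rel₂ (concat α (rev α) (src_rev α).symm) (triv (src α))
  rev_concat : ∀ {X Y : C} (α : Htpy X Y), Rel₂ (concat (rev α) α (tgt_rev α)) (triv (tgt α))
  concat_assoc : ∀ {X Y : C} (α β δ : Htpy X Y) (h : tgt α = src β) (h' : tgt β = src δ),
    Rel₂ (concat (concat α β h) δ ((tgt_concat α β h).trans h'))
      (concat α (concat β δ h') (h.trans (src_concat β δ h').symm))
  -- reduced interchange up to 2-homotopy: for `α : f ≃ g`, `β : h ≃ k`, `h.α + β.g ≃₂ β.f + k.α`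
  interchange : ∀ {X Y Z : C} (α : Htpy X Y) (β : Htpy Y Z),
    Rel₂ (concat (post α (src β)) (pre (tgt α) β) (by rw [tgt_post, src_pre]))
      (concat (pre (src α) β) (post α (tgt β)) (by rw [tgt_pre, src_post]))

namespace HomotopyStructure

variable {C : Type u} [Category.{v} C] [HomotopyStructure.{w} C]

attribute [simp] src_pre tgt_pre src_post tgt_post src_triv tgt_triv src_rev tgt_rev
  src_concat tgt_concat

/-- `f ≃ g`: there is some homotopy from `f` to `g`. -/
def Homotopic {X Y : C} (f g : X ⟶ Y) : Prop := ∃ α : Htpy X Y, src α = f ∧ tgt α = g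

/-- `f` is a homotopy equivalence. -/
def IsHomotopyEquiv {X Y : C} (f : X ⟶ Y) : Prop :=
  ∃ g : Y ⟶ X, Homotopic (f ≫ g) (𝟙 X) ∧ Homotopic (g ≫ f) (𝟙 Y)

variable [HasZeroMorphisms C]

/-- `ξ` is a nullhomotopy `0 ≃ h`. -/
def IsNull {X Y : C} (ξ : Htpy X Y) (h : X ⟶ Y) : Prop := src ξ = 0 ∧ tgt ξ = h

/-- A homotopy kernel `(Kf, kf, κf)` of `f`: a triple with `κf : 0 ≃ f.kf`, satisfying the
(strict) 1-dimensional universal property and the 2-dimensional universal property. -/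
structure HKernel {A B : C} (f : A ⟶ B) where
  K : C
  k : K ⟶ A
  κ : Htpy K B
  null : IsNull κ (k ≫ f)
  univ : ∀ {X : C} (x : X ⟶ A) (ξ : Htpy X B), IsNull ξ (x ≫ f) →
    ∃! t : X ⟶ K, t ≫ k = x ∧ pre t κ = ξ
  -- `θ : k.a ≃ k.b` with `κ.a + f.θ ≃₂ κ.b` lifts to some `φ : a ≃ b` with `k.φ = θ`
  univ₂ : ∀ {X : C} (a b : X ⟶ K) (θ : Htpy X A) (hs : src θ = a ≫ k) (_ : tgt θ = b ≫ k),
    Rel₂ (concat (pre a κ) (post θ f) (by rw [tgt_pre, src_post, null.2, hs, Category.assoc]))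
      (pre b κ) →
    ∃ φ : Htpy X K, src φ = a ∧ tgt φ = b ∧ post φ k = θ

/-- A homotopy cokernel `(Cf, cf, γf)` of `f`: the dual notion, with `γf : 0 ≃ cf.f`. -/
structure HCokernel {A B : C} (f : A ⟶ B) where
  Q : C
  c : B ⟶ Q
  γ : Htpy A Q
  null : IsNull γ (f ≫ c)
  univ : ∀ {Y : C} (y : B ⟶ Y) (ξ : Htpy A Y), IsNull ξ (f ≫ y) →
    ∃! t : Q ⟶ Y, c ≫ t = y ∧ post γ t = ξ
  -- `θ : a.c ≃ b.c` with `a.γ + θ.f ≃₂ b.γ` extends to some `φ : a ≃ b` with `φ.c = θ`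
  univ₂ : ∀ {Y : C} (a b : Q ⟶ Y) (θ : Htpy B Y) (hs : src θ = c ≫ a) (_ : tgt θ = c ≫ b),
    Rel₂ (concat (post γ a) (pre f θ) (by rw [tgt_post, src_pre, null.2, hs, Category.assoc]))
      (post γ b) →
    ∃ φ : Htpy Q Y, src φ = a ∧ tgt φ = b ∧ pre c φ = θ

/-- The map into the h-kernel determined by `x` and `ξ : 0 ≃ f.x`. -/
noncomputable def HKernel.lift {A B : C} {f : A ⟶ B} (K : HKernel f) {X : C} (x : X ⟶ A)
    (ξ : Htpy X B) (h : IsNull ξ (x ≫ f)) : X ⟶ K.K :=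
  (K.univ x ξ h).choose

theorem HKernel.lift_k {A B : C} {f : A ⟶ B} (K : HKernel f) {X : C} (x : X ⟶ A)
    (ξ : Htpy X B) (h : IsNull ξ (x ≫ f)) : K.lift x ξ h ≫ K.k = x :=
  (K.univ x ξ h).choose_spec.1.1

theorem HKernel.lift_κ {A B : C} {f : A ⟶ B} (K : HKernel f) {X : C} (x : X ⟶ A)
    (ξ : Htpy X B) (h : IsNull ξ (x ≫ f)) : pre (K.lift x ξ h) K.κ = ξ :=
  (K.univ x ξ h).choose_spec.1.2

/-- The map out of the h-cokernel determined by `y` and `ξ : 0 ≃ y.f`. -/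
noncomputable def HCokernel.desc {A B : C} {f : A ⟶ B} (K : HCokernel f) {Y : C} (y : B ⟶ Y)
    (ξ : Htpy A Y) (h : IsNull ξ (f ≫ y)) : K.Q ⟶ Y :=
  (K.univ y ξ h).choose

theorem HCokernel.c_desc {A B : C} {f : A ⟶ B} (K : HCokernel f) {Y : C} (y : B ⟶ Y)
    (ξ : Htpy A Y) (h : IsNull ξ (f ≫ y)) : K.c ≫ K.desc y ξ h = y :=
  (K.univ y ξ h).choose_spec.1.1

theorem HCokernel.γ_desc {A B : C} {f : A ⟶ B} (K : HCokernel f) {Y : C} (y : B ⟶ Y)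
    (ξ : Htpy A Y) (h : IsNull ξ (f ≫ y)) : post K.γ (K.desc y ξ h) = ξ :=
  (K.univ y ξ h).choose_spec.1.2

end HomotopyStructure

open HomotopyStructure

/-- A pointed homotopical category: a category with homotopies and 2-homotopies as above, a zero
object which is also 2-dimensionally terminal and initial (all homotopies into it or out of it are
trivial), and a (standard) h-kernel and h-cokernel for each map. -/
class PointedHomotopicalCategory (C : Type u) [Category.{v} C] [HasZeroMorphisms C]
    [HasZeroObject C] extends HomotopyStructure.{w} C where
  htpy_to_zero : ∀ {X Z : C}, IsZero Z → ∀ α : Htpy X Z, α = triv (src α)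
  htpy_from_zero : ∀ {Z Y : C}, IsZero Z → ∀ α : Htpy Z Y, α = triv (src α)
  hker : ∀ {A B : C} (f : A ⟶ B), HKernel f
  hcok : ∀ {A B : C} (f : A ⟶ B), HCokernel f

open PointedHomotopicalCategory

/-- An h-differential sequence `(f, g; α)`: maps `f : X ⟶ A`, `g : A ⟶ Y` with a nullhomotopy
`α : 0 ≃ g.f`. -/
structure HDiffSeq (C : Type u) [Category.{v} C] [HasZeroMorphisms C]
    [HomotopyStructure.{w} C] where
  {X A Y : C}
  f : X ⟶ A
  g : A ⟶ Y
  α : Htpy X Y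
  null : IsNull α (f ≫ g)

namespace HDiffSeq

/-- The sequences `S = (f, g; α)` and `T = (x, y; β)` are (coherently) equivalent: there are
homotopy equivalences `u'`, `u`, `u''` and homotopies `φ : u.f ≃ x.u'`, `ψ : u''.g ≃ y.u`
with `β.u' - y.φ ≃₂ u''.α + ψ.f`. -/
def Equivalent {C : Type u} [Category.{v} C] [HasZeroMorphisms C] [HomotopyStructure.{w} C]
    (S T : HDiffSeq.{w} C) : Prop :=
  ∃ (u₁ : S.X ⟶ T.X) (u₀ : S.A ⟶ T.A) (u₂ : S.Y ⟶ T.Y) (φ : Htpy S.X T.A) (ψ : Htpy S.A T.Y)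
    (_ : src φ = S.f ≫ u₀) (hφt : tgt φ = u₁ ≫ T.f)
    (hψs : src ψ = S.g ≫ u₂) (_ : tgt ψ = u₀ ≫ T.g),
    IsHomotopyEquiv u₁ ∧ IsHomotopyEquiv u₀ ∧ IsHomotopyEquiv u₂ ∧
    Rel₂
      (concat (pre u₁ T.α) (rev (post φ T.g))
        (by rw [tgt_pre, src_rev, tgt_post, hφt, T.null.2, Category.assoc]))
      (concat (post S.α u₂) (pre S.f ψ)
        (by rw [tgt_post, src_pre, hψs, S.null.2, Category.assoc]))

variable {C : Type u} [Category.{v} C] [HasZeroMorphisms C] [HasZeroObject C]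
  [PointedHomotopicalCategory.{w} C]

/-- The sequence `(kg, g; κg)`. -/
def kernelSeq {A Y : C} (g : A ⟶ Y) : HDiffSeq.{w} C :=
  ⟨(hker g).k, g, (hker g).κ, (hker g).null⟩

variable (S : HDiffSeq.{w} C)

/-- `u_α : X ⟶ Kg`, with `kg.u_α = f` and `κg.u_α = α`. -/
noncomputable def uα : S.X ⟶ (hker S.g).K := (hker S.g).lift S.f S.α S.null

/-- `v_α : Cf ⟶ Y`, with `v_α.cf = g` and `v_α.γf = α`. -/
noncomputable def vα : (hcok S.f).Q ⟶ S.Y := (hcok S.f).desc S.g S.α S.null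

/-- `u = k(v_α) : Kcf ⟶ Kg`, with `kg.u = kcf` and `κg.u = v_α.κcf`. -/
noncomputable def uMap : (hker (hcok S.f).c).K ⟶ (hker S.g).K :=
  (hker S.g).lift (hker (hcok S.f).c).k (post (hker (hcok S.f).c).κ S.vα)
    ⟨by rw [src_post, (hker (hcok S.f).c).null.1, zero_comp],
     by rw [tgt_post, (hker (hcok S.f).c).null.2, Category.assoc, vα, HCokernel.c_desc]⟩

/-- `v = c(u_α) : Cf ⟶ Ckg`, with `v.cf = ckg` and `v.γf = γkg.u_α`. -/
noncomputable def vMap : (hcok S.f).Q ⟶ (hcok (hker S.g).k).Q :=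
  (hcok S.f).desc (hcok (hker S.g).k).c (pre S.uα (hcok (hker S.g).k).γ)
    ⟨by rw [src_pre, (hcok (hker S.g).k).null.1, comp_zero],
     by rw [tgt_pre, (hcok (hker S.g).k).null.2, ← Category.assoc, uα, HKernel.lift_k]⟩

def LeftHExact : Prop := IsHomotopyEquiv S.uα

def RightHExact : Prop := IsHomotopyEquiv S.vα

def StronglyHExact : Prop := S.LeftHExact ∧ S.RightHExact

def HExact : Prop := IsHomotopyEquiv S.uMap ∧ IsHomotopyEquiv S.vMap

end HDiffSeq

/-! Everything reduces to the invariance of left h-exactness, together with duality. A coherent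
square `(u₀, u₂, ψ)` from `g` to `g'` induces a map `t` of h-kernels, and `t` is a homotopy
equivalence when `u₀` and `u₂` are (`HKernel.isHomotopyEquiv_of_square`). The homotopy inverses of
`u₀` and `u₂` need not satisfy triangle identities, so `HKernel.exists_retraction` only gives `t` a
one-sided inverse `t'`. Since `t'` is induced by a square of the same kind, it has such an inverse
too, and the two together suffice. For equivalent sequences, the coherence condition says exactly
that `φ` lifts to a homotopy between `S.uα ≫ t` and `u₁ ≫ T.uα`; two-out-of-three then compares
`S.uα` with `T.uα`. Right h-exactness is the same statement in `Cᵒᵖ`. For h-exactness, `uMap` is the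
comparison map `uα` of the sequence `imageSeq`, which is preserved by equivalence, and `vMap` is
dual to `uMap`. In the second claim, `uα` with identities is an equivalence to the kernel sequence;
conversely the kernel sequence is left h-exact, its `uα` being an identity. Computations take place
with homotopies modulo 2-homotopy (`HClass`), where the groupoid laws and interchange are
equalities. -/

namespace HomotopyStructure

/-! ### Homotopy equivalences as isomorphisms of the homotopy category. -/

section Homotopic

variable {C : Type u} [Category.{v} C] [HomotopyStructure.{w} C]

theorem Homotopic.refl {X Y : C} (f : X ⟶ Y) : Homotopic f f :=
  ⟨triv f, src_triv f, tgt_triv f⟩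

theorem Homotopic.symm {X Y : C} {f g : X ⟶ Y} (h : Homotopic f g) : Homotopic g f := by
  obtain ⟨α, rfl, rfl⟩ := h
  exact ⟨rev α, src_rev α, tgt_rev α⟩

theorem Homotopic.trans {X Y : C} {f g h : X ⟶ Y} (h₁ : Homotopic f g) (h₂ : Homotopic g h) :
    Homotopic f h := by
  obtain ⟨α, rfl, hα⟩ := h₁
  obtain ⟨β, hβ, rfl⟩ := h₂
  exact ⟨concat α β (hα.trans hβ.symm), src_concat .., tgt_concat ..⟩

theorem Homotopic.comp_left {W X Y : C} (p : W ⟶ X) {f g : X ⟶ Y} (h : Homotopic f g) :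
    Homotopic (p ≫ f) (p ≫ g) := by
  obtain ⟨α, rfl, rfl⟩ := h
  exact ⟨pre p α, src_pre p α, tgt_pre p α⟩

theorem Homotopic.comp_right {X Y Z : C} {f g : X ⟶ Y} (h : Homotopic f g) (q : Y ⟶ Z) :
    Homotopic (f ≫ q) (g ≫ q) := by
  obtain ⟨α, rfl, rfl⟩ := h
  exact ⟨post α q, src_post α q, tgt_post α q⟩

variable (C) in
/-- The relation of homotopy, as a relation on the morphisms of `C`. -/
def homotopicRel : HomRel C := fun _ _ f g => Homotopic f g

instance : Congruence (homotopicRel C) where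
  equivalence := ⟨Homotopic.refl, Homotopic.symm, Homotopic.trans⟩
  comp_left p _ _ h := Homotopic.comp_left p h
  comp_right q h := Homotopic.comp_right h q

variable (C) in
/-- The projection onto the homotopy category. -/
def toHo : C ⥤ Quotient (homotopicRel C) := Quotient.functor _

theorem toHo_map_eq_iff {X Y : C} (f g : X ⟶ Y) :
    (toHo C).map f = (toHo C).map g ↔ Homotopic f g :=
  Quotient.functor_map_eq_iff (homotopicRel C) f g

theorem isHomotopyEquiv_iff_isIso {X Y : C} (f : X ⟶ Y) :
    IsHomotopyEquiv f ↔ IsIso ((toHo C).map f) := by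
  constructor
  · rintro ⟨g, h₁, h₂⟩
    refine ⟨(toHo C).map g, ?_, ?_⟩
    · rw [← Functor.map_comp, (toHo_map_eq_iff _ _).2 h₁, CategoryTheory.Functor.map_id]
    · rw [← Functor.map_comp, (toHo_map_eq_iff _ _).2 h₂, CategoryTheory.Functor.map_id]
  · rintro ⟨g, h₁, h₂⟩
    obtain ⟨g, rfl⟩ := (Quotient.functor (homotopicRel C)).map_surjective g
    refine ⟨g, (toHo_map_eq_iff _ _).1 ?_, (toHo_map_eq_iff _ _).1 ?_⟩
    · rw [Functor.map_comp, CategoryTheory.Functor.map_id]; exact h₁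
    · rw [Functor.map_comp, CategoryTheory.Functor.map_id]; exact h₂

theorem IsHomotopyEquiv.id (X : C) : IsHomotopyEquiv (𝟙 X) := by
  rw [isHomotopyEquiv_iff_isIso, CategoryTheory.Functor.map_id]; infer_instance

/-- In a square commuting up to homotopy with two opposite sides homotopy equivalences, the other
two sides are simultaneously homotopy equivalences. -/
theorem isHomotopyEquiv_iff_of_square {X Y X' Y' : C} {f : X ⟶ Y} {f' : X' ⟶ Y'}
    {p : X ⟶ X'} {q : Y ⟶ Y'} (h : Homotopic (f ≫ q) (p ≫ f'))
    (hp : IsHomotopyEquiv p) (hq : IsHomotopyEquiv q) :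
    IsHomotopyEquiv f ↔ IsHomotopyEquiv f' := by
  rw [isHomotopyEquiv_iff_isIso] at hp hq
  rw [isHomotopyEquiv_iff_isIso, isHomotopyEquiv_iff_isIso]
  rw [← toHo_map_eq_iff, Functor.map_comp, Functor.map_comp] at h
  rw [← isIso_comp_right_iff _ ((toHo C).map q), h, isIso_comp_left_iff]

/-- A map with a left homotopy inverse which itself has a left homotopy inverse is a homotopy
equivalence. -/
theorem IsHomotopyEquiv.of_retractions {X Y : C} {f : X ⟶ Y} {g : Y ⟶ X} {h : X ⟶ Y}
    (h₁ : Homotopic (f ≫ g) (𝟙 X)) (h₂ : Homotopic (g ≫ h) (𝟙 Y)) : IsHomotopyEquiv f := by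
  refine ⟨g, h₁, ?_⟩
  have h₃ : Homotopic f h := by
    have e₁ := h₂.comp_left f
    have e₂ := h₁.comp_right h
    rw [Category.comp_id] at e₁
    rw [Category.id_comp, Category.assoc] at e₂
    exact e₁.symm.trans e₂
  exact (h₃.comp_left g).trans h₂

theorem IsHomotopyEquiv.inverse {X Y : C} {f : X ⟶ Y} (hf : IsHomotopyEquiv f) :
    ∃ g : Y ⟶ X, IsHomotopyEquiv g ∧ Homotopic (f ≫ g) (𝟙 X) ∧ Homotopic (g ≫ f) (𝟙 Y) := by
  obtain ⟨g, h₁, h₂⟩ := hf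
  exact ⟨g, ⟨f, h₂, h₁⟩, h₁, h₂⟩

end Homotopic

/-! ### The groupoid calculus of homotopies modulo 2-homotopy. -/

section HClass

variable {C : Type u} [Category.{v} C] [HomotopyStructure.{w} C]

/-- The classes of homotopies up to 2-homotopy. -/
def HClass (X Y : C) : Type w := _root_.Quotient (⟨Rel₂, rel_equiv X Y⟩ : Setoid (Htpy X Y))

namespace HClass

/-- The class of a homotopy. -/
def mk {X Y : C} (α : Htpy X Y) : HClass X Y := _root_.Quotient.mk _ α

theorem mk_eq_mk {X Y : C} {α β : Htpy X Y} : mk α = mk β ↔ Rel₂ α β := Quotient.eq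

theorem mk_surjective {X Y : C} (a : HClass X Y) : ∃ α, mk α = a := Quotient.exists_rep a

def src {X Y : C} (a : HClass X Y) : X ⟶ Y :=
  Quotient.lift HomotopyStructure.src (fun _ _ h => rel_src h) a

def tgt {X Y : C} (a : HClass X Y) : X ⟶ Y :=
  Quotient.lift HomotopyStructure.tgt (fun _ _ h => rel_tgt h) a

def pre {W X Y : C} (p : W ⟶ X) (a : HClass X Y) : HClass W Y :=
  Quotient.map (HomotopyStructure.pre p) (fun _ _ h => rel_pre p h) a

def post {X Y Z : C} (a : HClass X Y) (q : Y ⟶ Z) : HClass X Z :=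
  Quotient.map (HomotopyStructure.post · q) (fun _ _ h => rel_post q h) a

def rev {X Y : C} (a : HClass X Y) : HClass X Y :=
  Quotient.map HomotopyStructure.rev (fun _ _ h => rel_rev h) a

def triv {X Y : C} (f : X ⟶ Y) : HClass X Y := mk (HomotopyStructure.triv f)

open Classical in
/-- Concatenation of classes of homotopies, extended by a junk value to non-consecutive ones. -/
noncomputable instance {X Y : C} : Add (HClass X Y) where
  add a b := Quotient.liftOn₂ a b
    (fun α β => if h : HomotopyStructure.tgt α = HomotopyStructure.src β
      then mk (concat α β h) else triv (HomotopyStructure.src α)) (by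
    intro α β α' β' hα hβ
    have e₁ := rel_tgt hα
    have e₂ := rel_src hβ
    split_ifs with h h' h'
    · exact mk_eq_mk.2 (rel_concat _ _ hα hβ)
    · exact absurd (e₁.symm.trans (h.trans e₂)) h'
    · exact absurd (e₁.trans (h'.trans e₂.symm)) h
    · rw [rel_src hα])

theorem mk_add_mk {X Y : C} (α β : Htpy X Y)
    (h : HomotopyStructure.tgt α = HomotopyStructure.src β) : mk α + mk β = mk (concat α β h) :=
  dif_pos h

@[simp] theorem src_mk {X Y : C} (α : Htpy X Y) : src (mk α) = HomotopyStructure.src α := rfl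
@[simp] theorem tgt_mk {X Y : C} (α : Htpy X Y) : tgt (mk α) = HomotopyStructure.tgt α := rfl
theorem mk_pre {W X Y : C} (p : W ⟶ X) (α : Htpy X Y) :
    mk (HomotopyStructure.pre p α) = pre p (mk α) := rfl
theorem mk_post {X Y Z : C} (α : Htpy X Y) (q : Y ⟶ Z) :
    mk (HomotopyStructure.post α q) = post (mk α) q := rfl
theorem mk_rev {X Y : C} (α : Htpy X Y) : mk (HomotopyStructure.rev α) = rev (mk α) := rfl

@[simp] theorem src_pre {W X Y : C} (p : W ⟶ X) (a : HClass X Y) : src (pre p a) = p ≫ src a := by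
  obtain ⟨α, rfl⟩ := mk_surjective a
  exact HomotopyStructure.src_pre p α

@[simp] theorem tgt_pre {W X Y : C} (p : W ⟶ X) (a : HClass X Y) : tgt (pre p a) = p ≫ tgt a := by
  obtain ⟨α, rfl⟩ := mk_surjective a
  exact HomotopyStructure.tgt_pre p α

@[simp] theorem src_post {X Y Z : C} (a : HClass X Y) (q : Y ⟶ Z) :
    src (post a q) = src a ≫ q := by
  obtain ⟨α, rfl⟩ := mk_surjective a
  exact HomotopyStructure.src_post α q

@[simp] theorem tgt_post {X Y Z : C} (a : HClass X Y) (q : Y ⟶ Z) :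
    tgt (post a q) = tgt a ≫ q := by
  obtain ⟨α, rfl⟩ := mk_surjective a
  exact HomotopyStructure.tgt_post α q

@[simp] theorem src_rev {X Y : C} (a : HClass X Y) : src (rev a) = tgt a := by
  obtain ⟨α, rfl⟩ := mk_surjective a
  exact HomotopyStructure.src_rev α

@[simp] theorem tgt_rev {X Y : C} (a : HClass X Y) : tgt (rev a) = src a := by
  obtain ⟨α, rfl⟩ := mk_surjective a
  exact HomotopyStructure.tgt_rev α

@[simp] theorem src_triv {X Y : C} (f : X ⟶ Y) : src (triv f) = f := HomotopyStructure.src_triv f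
@[simp] theorem tgt_triv {X Y : C} (f : X ⟶ Y) : tgt (triv f) = f := HomotopyStructure.tgt_triv f

theorem src_add {X Y : C} {a b : HClass X Y} (h : tgt a = src b) : src (a + b) = src a := by
  obtain ⟨α, rfl⟩ := mk_surjective a
  obtain ⟨β, rfl⟩ := mk_surjective b
  rw [mk_add_mk α β h]
  exact src_concat α β h

theorem tgt_add {X Y : C} {a b : HClass X Y} (h : tgt a = src b) : tgt (a + b) = tgt b := by
  obtain ⟨α, rfl⟩ := mk_surjective a
  obtain ⟨β, rfl⟩ := mk_surjective b
  rw [mk_add_mk α β h]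
  exact tgt_concat α β h

theorem add_assoc {X Y : C} {a b c : HClass X Y} (h : tgt a = src b) (h' : tgt b = src c) :
    a + b + c = a + (b + c) := by
  obtain ⟨α, rfl⟩ := mk_surjective a
  obtain ⟨β, rfl⟩ := mk_surjective b
  obtain ⟨δ, rfl⟩ := mk_surjective c
  simp only [src_mk, tgt_mk] at h h'
  rw [mk_add_mk α β h, mk_add_mk β δ h', mk_add_mk _ _ ((tgt_concat α β h).trans h'),
    mk_add_mk _ _ (h.trans (src_concat β δ h').symm), mk_eq_mk]
  exact concat_assoc α β δ h h'

theorem triv_add {X Y : C} {f : X ⟶ Y} {a : HClass X Y} (h : src a = f) : triv f + a = a := by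
  subst h
  obtain ⟨α, rfl⟩ := mk_surjective a
  exact (mk_add_mk _ _ (HomotopyStructure.tgt_triv _)).trans (mk_eq_mk.2 (triv_concat α))

theorem add_triv {X Y : C} {f : X ⟶ Y} {a : HClass X Y} (h : tgt a = f) : a + triv f = a := by
  subst h
  obtain ⟨α, rfl⟩ := mk_surjective a
  exact (mk_add_mk _ _ (HomotopyStructure.src_triv _).symm).trans (mk_eq_mk.2 (concat_triv α))

theorem add_rev {X Y : C} (a : HClass X Y) : a + rev a = triv (src a) := by
  obtain ⟨α, rfl⟩ := mk_surjective a
  exact (mk_add_mk _ _ (HomotopyStructure.src_rev _).symm).trans (mk_eq_mk.2 (concat_rev α))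

theorem rev_add {X Y : C} (a : HClass X Y) : rev a + a = triv (tgt a) := by
  obtain ⟨α, rfl⟩ := mk_surjective a
  exact (mk_add_mk _ _ (HomotopyStructure.tgt_rev _)).trans (mk_eq_mk.2 (rev_concat α))

theorem pre_id {X Y : C} (a : HClass X Y) : pre (𝟙 X) a = a := by
  obtain ⟨α, rfl⟩ := mk_surjective a
  exact congrArg mk (HomotopyStructure.pre_id α)

theorem post_id {X Y : C} (a : HClass X Y) : post a (𝟙 Y) = a := by
  obtain ⟨α, rfl⟩ := mk_surjective a
  exact congrArg mk (HomotopyStructure.post_id α)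

theorem pre_comp {V W X Y : C} (p : V ⟶ W) (q : W ⟶ X) (a : HClass X Y) :
    pre (p ≫ q) a = pre p (pre q a) := by
  obtain ⟨α, rfl⟩ := mk_surjective a
  exact congrArg mk (HomotopyStructure.pre_comp p q α)

theorem post_comp {X Y Z T : C} (a : HClass X Y) (p : Y ⟶ Z) (q : Z ⟶ T) :
    post a (p ≫ q) = post (post a p) q := by
  obtain ⟨α, rfl⟩ := mk_surjective a
  exact congrArg mk (HomotopyStructure.post_comp α p q)

theorem post_pre {W X Y Z : C} (p : W ⟶ X) (a : HClass X Y) (q : Y ⟶ Z) :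
    post (pre p a) q = pre p (post a q) := by
  obtain ⟨α, rfl⟩ := mk_surjective a
  exact congrArg mk (HomotopyStructure.post_pre p α q)

theorem pre_rev {W X Y : C} (p : W ⟶ X) (a : HClass X Y) : pre p (rev a) = rev (pre p a) := by
  obtain ⟨α, rfl⟩ := mk_surjective a
  exact congrArg mk (HomotopyStructure.pre_rev p α)

theorem post_rev {X Y Z : C} (a : HClass X Y) (q : Y ⟶ Z) : post (rev a) q = rev (post a q) := by
  obtain ⟨α, rfl⟩ := mk_surjective a
  exact congrArg mk (HomotopyStructure.post_rev α q)

theorem pre_triv {W X Y : C} (p : W ⟶ X) (f : X ⟶ Y) : pre p (triv f) = triv (p ≫ f) :=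
  congrArg mk (HomotopyStructure.pre_triv p f)

theorem post_triv {X Y Z : C} (f : X ⟶ Y) (q : Y ⟶ Z) : post (triv f) q = triv (f ≫ q) :=
  congrArg mk (HomotopyStructure.post_triv f q)

theorem pre_add {W X Y : C} (p : W ⟶ X) {a b : HClass X Y} (h : tgt a = src b) :
    pre p (a + b) = pre p a + pre p b := by
  obtain ⟨α, rfl⟩ := mk_surjective a
  obtain ⟨β, rfl⟩ := mk_surjective b
  simp only [src_mk, tgt_mk] at h
  rw [mk_add_mk α β h, ← mk_pre, ← mk_pre, ← mk_pre,
    mk_add_mk _ _ (by rw [HomotopyStructure.src_pre, HomotopyStructure.tgt_pre, h]), pre_concat]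

theorem post_add {X Y Z : C} {a b : HClass X Y} (h : tgt a = src b) (q : Y ⟶ Z) :
    post (a + b) q = post a q + post b q := by
  obtain ⟨α, rfl⟩ := mk_surjective a
  obtain ⟨β, rfl⟩ := mk_surjective b
  simp only [src_mk, tgt_mk] at h
  rw [mk_add_mk α β h, ← mk_post, ← mk_post, ← mk_post,
    mk_add_mk _ _ (by rw [HomotopyStructure.src_post, HomotopyStructure.tgt_post, h]), post_concat]

theorem interchange {X Y Z : C} (a : HClass X Y) (b : HClass Y Z) :
    post a (src b) + pre (tgt a) b = pre (src a) b + post a (tgt b) := by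
  obtain ⟨α, rfl⟩ := mk_surjective a
  obtain ⟨β, rfl⟩ := mk_surjective b
  simp only [src_mk, tgt_mk]
  rw [← mk_post, ← mk_post, ← mk_pre, ← mk_pre, mk_add_mk _ _ (by simp), mk_add_mk _ _ (by simp),
    mk_eq_mk]
  exact HomotopyStructure.interchange α β

theorem rev_add_cancel {X Y : C} {a b : HClass X Y} (h : tgt a = src b) :
    rev a + (a + b) = b := by
  rw [← add_assoc (by simp) h, rev_add, triv_add h.symm]

theorem add_rev_cancel {X Y : C} {a b : HClass X Y} (h : src a = src b) :
    a + (rev a + b) = b := by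
  rw [← add_assoc (by simp) (by simpa using h), add_rev, triv_add h.symm]

theorem add_rev_add_cancel {X Y : C} {a b : HClass X Y} (h : tgt a = tgt b) :
    a + rev b + b = a := by
  rw [add_assoc (by simpa using h) (by simp), rev_add, add_triv h]

theorem add_right_cancel {X Y : C} {a b c : HClass X Y} (ha : tgt a = src c) (hb : tgt b = src c)
    (h : a + c = b + c) : a = b := by
  rw [← add_triv ha, ← add_triv hb, ← add_rev c, ← add_assoc ha (by simp), h,
    add_assoc hb (by simp)]

theorem add_left_cancel {X Y : C} {a b c : HClass X Y} (ha : tgt c = src a) (hb : tgt c = src b)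
    (h : c + a = c + b) : a = b := by
  rw [← rev_add_cancel ha, h, rev_add_cancel hb]

theorem rev_rev {X Y : C} (a : HClass X Y) : rev (rev a) = a := by
  refine add_left_cancel (c := rev a) (by simp) (by simp) ?_
  rw [add_rev, rev_add, src_rev]

theorem rev_triv {X Y : C} (f : X ⟶ Y) : rev (triv f) = triv f := by
  refine add_left_cancel (c := triv f) (by simp) (by simp) ?_
  rw [add_rev, src_triv, triv_add (src_triv f)]

/-- Precomposition with a map having a left homotopy inverse is faithful on homotopies. -/
theorem pre_injective {X Y Z : C} {v : Y ⟶ X} {u : X ⟶ Y} (h : Homotopic (u ≫ v) (𝟙 X))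
    {a b : HClass X Z} (hs : src a = src b) (ht : tgt a = tgt b) (hab : pre v a = pre v b) :
    a = b := by
  obtain ⟨η, h₁, h₂⟩ := h
  -- Interchange with `η` exhibits `a` as a conjugate of `pre u (pre v a)` by whiskerings of `η`
  -- that depend only on the endpoints of `a`.
  have ea := interchange (mk η) a
  have eb := interchange (mk η) b
  simp only [src_mk, tgt_mk, h₁, h₂, pre_id, pre_comp] at ea eb
  refine add_left_cancel (c := post (mk η) (src a)) (by simp [h₂]) (by simp [h₂, hs]) ?_
  rw [ea, hs, eb, ht, hab]

/-- Precomposition with a homotopy equivalence is full on homotopies. -/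
theorem exists_pre_eq {A B Z : C} {u : A ⟶ B} (hu : IsHomotopyEquiv u) {a b : B ⟶ Z}
    {z : HClass A Z} (hs : src z = u ≫ a) (ht : tgt z = u ≫ b) :
    ∃ x : HClass B Z, src x = a ∧ tgt x = b ∧ pre u x = z := by
  obtain ⟨v, hη, ε, h₁, h₂⟩ := hu
  -- The preimage is `z` transported along `v` and conjugated by `ε : v ≫ u ≃ 𝟙`, so that it runs
  -- from `a` to `b`.
  have c₁ : tgt (rev (post (mk ε) a)) = src (pre v z) := by simp [h₁, hs]
  have c₂ : tgt (pre v z) = src (post (mk ε) b) := by simp [h₁, ht]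
  have c₃ : tgt (rev (post (mk ε) a)) = src (pre v z + post (mk ε) b) := by rw [src_add c₂, c₁]
  have hxs : src (rev (post (mk ε) a) + (pre v z + post (mk ε) b)) = a := by
    rw [src_add c₃]; simp [h₂]
  have hxt : tgt (rev (post (mk ε) a) + (pre v z + post (mk ε) b)) = b := by
    rw [tgt_add c₃, tgt_add c₂]; simp [h₂]
  refine ⟨_, hxs, hxt, ?_⟩
  -- As `pre v` is faithful, it is enough to compare after whiskering with `v`, where interchange
  -- with `ε` undoes the conjugation.
  refine pre_injective hη (by simp [hs, hxs]) (by simp [ht, hxt]) ?_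
  have e := interchange (mk ε) (rev (post (mk ε) a) + (pre v z + post (mk ε) b))
  rw [hxs, hxt, src_mk, tgt_mk, h₁, h₂, pre_id, add_rev_cancel (by rw [src_add c₂]; simpa using c₁)]
    at e
  rw [← pre_comp]
  exact (add_right_cancel c₂ (by simp [hxt, h₁]) e).symm

end HClass

end HClass

end HomotopyStructure

namespace HomotopyStructure

/-! ### Universal properties of h-kernels and h-cokernels on classes. -/

section Kernels

variable {C : Type u} [Category.{v} C] [HasZeroMorphisms C] [HomotopyStructure.{w} C]

theorem HKernel.hom_ext {A B : C} {f : A ⟶ B} (K : HKernel f) {X : C} {s t : X ⟶ K.K}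
    (h : s ≫ K.k = t ≫ K.k) (h' : pre s K.κ = pre t K.κ) : s = t := by
  refine (K.univ (t ≫ K.k) (pre t K.κ) ⟨?_, ?_⟩).unique ⟨h, h'⟩ ⟨rfl, rfl⟩
  · rw [src_pre, K.null.1, comp_zero]
  · rw [tgt_pre, K.null.2, Category.assoc]

theorem HCokernel.hom_ext {A B : C} {f : A ⟶ B} (K : HCokernel f) {Y : C} {s t : K.Q ⟶ Y}
    (h : K.c ≫ s = K.c ≫ t) (h' : post K.γ s = post K.γ t) : s = t := by
  refine (K.univ (K.c ≫ t) (post K.γ t) ⟨?_, ?_⟩).unique ⟨h, h'⟩ ⟨rfl, rfl⟩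
  · rw [src_post, K.null.1, zero_comp]
  · rw [tgt_post, K.null.2, Category.assoc]

/-- The lift is taken for a chosen representative of `ξ`, so uniqueness is not retained. -/
theorem HKernel.exists_lift {A B : C} {f : A ⟶ B} (K : HKernel f) {X : C} (x : X ⟶ A)
    {ξ : HClass X B} (hs : ξ.src = 0) (ht : ξ.tgt = x ≫ f) :
    ∃ t : X ⟶ K.K, t ≫ K.k = x ∧ HClass.pre t (HClass.mk K.κ) = ξ := by
  obtain ⟨ξ, rfl⟩ := HClass.mk_surjective ξ
  obtain ⟨t, ⟨h₁, h₂⟩, -⟩ := K.univ x ξ ⟨hs, ht⟩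
  exact ⟨t, h₁, congrArg HClass.mk h₂⟩

theorem HKernel.homotopic {A B : C} {f : A ⟶ B} (K : HKernel f) {X : C} {a b : X ⟶ K.K}
    {θ : HClass X A} (hs : θ.src = a ≫ K.k) (ht : θ.tgt = b ≫ K.k)
    (h : HClass.pre a (HClass.mk K.κ) + HClass.post θ f = HClass.pre b (HClass.mk K.κ)) :
    Homotopic a b := by
  obtain ⟨θ, rfl⟩ := HClass.mk_surjective θ
  simp only [HClass.src_mk, HClass.tgt_mk] at hs ht
  rw [← HClass.mk_pre, ← HClass.mk_pre, ← HClass.mk_post,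
    HClass.mk_add_mk _ _ (by rw [tgt_pre, src_post, K.null.2, hs, Category.assoc]),
    HClass.mk_eq_mk] at h
  obtain ⟨φ, h₁, h₂, -⟩ := K.univ₂ a b θ hs ht h
  exact ⟨φ, h₁, h₂⟩

theorem HCokernel.exists_htpy {A B : C} {f : A ⟶ B} (K : HCokernel f) {Y : C} {a b : K.Q ⟶ Y}
    {θ : HClass B Y} (hs : θ.src = K.c ≫ a) (ht : θ.tgt = K.c ≫ b)
    (h : HClass.post (HClass.mk K.γ) a + HClass.pre f θ = HClass.post (HClass.mk K.γ) b) :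
    ∃ φ : HClass K.Q Y, φ.src = a ∧ φ.tgt = b ∧ HClass.pre K.c φ = θ := by
  obtain ⟨θ, rfl⟩ := HClass.mk_surjective θ
  simp only [HClass.src_mk, HClass.tgt_mk] at hs ht
  rw [← HClass.mk_pre, ← HClass.mk_post, ← HClass.mk_post,
    HClass.mk_add_mk _ _ (by rw [tgt_post, src_pre, K.null.2, hs, Category.assoc]),
    HClass.mk_eq_mk] at h
  obtain ⟨φ, h₁, h₂, h₃⟩ := K.univ₂ a b θ hs ht h
  exact ⟨HClass.mk φ, h₁, h₂, congrArg HClass.mk h₃⟩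

end Kernels

/-! ### Maps of h-kernels induced by homotopy commutative squares. -/

section Pointed

variable {C : Type u} [Category.{v} C] [HasZeroMorphisms C] [HasZeroObject C]
  [PointedHomotopicalCategory.{w} C]

/-- A zero map factors through a zero object, and homotopies out of that object are trivial. -/
theorem HClass.pre_zero {W X Y : C} (a : HClass X Y) :
    HClass.pre (0 : W ⟶ X) a = HClass.triv 0 := by
  obtain ⟨α, rfl⟩ := HClass.mk_surjective a
  obtain ⟨Z, hZ⟩ := HasZeroObject.zero (C := C)
  rw [← zero_comp (X := W) (Y := Z) (f := (0 : Z ⟶ X)), HClass.pre_comp, ← HClass.mk_pre,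
    htpy_from_zero hZ (HomotopyStructure.pre 0 α)]
  exact (HClass.pre_triv _ _).trans (by rw [zero_comp])

/-- A nullhomotopy followed by a whiskered homotopy `b : h ≃ k` only depends on `k`. -/
theorem HClass.null_post_add {X Y Z : C} {a : HClass X Y} (ha : a.src = 0) (b : HClass Y Z) :
    a.post b.src + b.pre a.tgt = a.post b.tgt := by
  rw [HClass.interchange, ha, HClass.pre_zero, HClass.triv_add (by simp [ha])]

/-- The map of h-kernels induced by a square commuting up to homotopy, with vertical maps homotopy
equivalences, has a left homotopy inverse which is induced in the same way. -/
theorem HKernel.exists_retraction {A B A' B' : C} {g : A ⟶ B} {g' : A' ⟶ B'} (K : HKernel g)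
    (K' : HKernel g') {a : A ⟶ A'} {b : B ⟶ B'} (ha : IsHomotopyEquiv a) (hb : IsHomotopyEquiv b)
    {ψ : HClass A B'} (hs : ψ.src = g ≫ b) (ht : ψ.tgt = a ≫ g') {t : K.K ⟶ K'.K}
    (h₁ : t ≫ K'.k = K.k ≫ a)
    (h₂ : HClass.pre t (HClass.mk K'.κ) = HClass.post (HClass.mk K.κ) b + HClass.pre K.k ψ) :
    ∃ (a' : A' ⟶ A) (b' : B' ⟶ B) (χ : HClass A' B) (t' : K'.K ⟶ K.K),
      IsHomotopyEquiv a' ∧ IsHomotopyEquiv b' ∧ χ.src = g' ≫ b' ∧ χ.tgt = a' ≫ g ∧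
      t' ≫ K.k = K'.k ≫ a' ∧
      HClass.pre t' (HClass.mk K.κ) = HClass.post (HClass.mk K'.κ) b' + HClass.pre K'.k χ ∧
      Homotopic (t ≫ t') (𝟙 _) := by
  obtain ⟨a', ha', ⟨η, hη₁, hη₂⟩, -⟩ := ha.inverse
  obtain ⟨b', hb', ⟨θ, hθ₁, hθ₂⟩, -⟩ := hb.inverse
  have n₁ := K.null.1
  have n₂ := K.null.2
  have n₁' := K'.null.1
  have n₂' := K'.null.2
  have c₁ : (HClass.pre g (HClass.mk θ)).tgt = (HClass.post (HClass.mk η) g).rev.src := by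
    simp [hη₂, hθ₂]
  have c₂ : (ψ.post b').rev.tgt =
      (HClass.pre g (HClass.mk θ) + (HClass.post (HClass.mk η) g).rev).src := by
    rw [HClass.src_add c₁]; simp [hs, hθ₁]
  -- `χ` is dictated by the pasting of the two squares: `ψ.b' + χ.a + g.η` must equal `θ.g`. Solving
  -- for `χ.a` gives `z`, and fullness of whiskering with `a` supplies `χ`.
  obtain ⟨χ, hχs, hχt, hχ⟩ := HClass.exists_pre_eq ha (a := g' ≫ b') (b := a' ≫ g)
    (z := (ψ.post b').rev + (HClass.pre g (HClass.mk θ) + (HClass.post (HClass.mk η) g).rev))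
    (by rw [HClass.src_add c₂]; simp [ht])
    (by rw [HClass.tgt_add c₂, HClass.tgt_add c₁]; simp [hη₁])
  have c₃ : (HClass.post (HClass.mk K'.κ) b').tgt = (HClass.pre K'.k χ).src := by
    simp [n₂', hχs]
  obtain ⟨t', h₁', h₂'⟩ := K.exists_lift (K'.k ≫ a')
    (ξ := HClass.post (HClass.mk K'.κ) b' + HClass.pre K'.k χ)
    (by rw [HClass.src_add c₃]; simp [n₁'])
    (by rw [HClass.tgt_add c₃]; simp [hχt])
  refine ⟨a', b', χ, t', ha', hb', hχs, hχt, h₁', h₂', ?_⟩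
  have hk : (t ≫ t') ≫ K.k = K.k ≫ a ≫ a' := by
    rw [Category.assoc, h₁', ← Category.assoc, h₁, Category.assoc]
  -- The homotopy from `t ≫ t'` to the identity lifts `η` whiskered with `K.k`. The equation for `χ`
  -- reduces the lifting condition to interchange of `K.κ` with `θ`, where the nullity of the source
  -- of `K.κ` removes one term.
  refine K.homotopic (θ := HClass.pre K.k (HClass.mk η)) (by simp [hk, hη₁]) (by simp [hη₂]) ?_
  have e : χ.pre a + HClass.post (HClass.mk η) g =
      (ψ.post b').rev + HClass.pre g (HClass.mk θ) := by
    rw [hχ, HClass.add_assoc c₂ (by rw [HClass.tgt_add c₁]; simp),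
      HClass.add_rev_add_cancel (by simp [hη₂, hθ₂])]
  have c₄ : (HClass.post (HClass.mk K.κ) b).tgt = (HClass.pre K.k ψ).src := by simp [n₂, hs]
  have c₅ : ((HClass.mk K.κ).post (b ≫ b')).tgt = ((ψ.post b').pre K.k).src := by simp [n₂, hs]
  have c₆ : ((ψ.post b').pre K.k).tgt = ((χ.pre a).pre K.k).src := by simp [ht, hχs]
  have c₇ : ((χ.pre a).pre K.k).tgt = ((HClass.post (HClass.mk η) g).pre K.k).src := by
    simp [hη₁, hχt]
  rw [HClass.pre_comp, h₂', HClass.pre_add _ c₃, ← HClass.post_pre, h₂, HClass.post_add c₄,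
    ← HClass.pre_comp, h₁, HClass.pre_comp, HClass.post_pre, HClass.post_pre, ← HClass.post_comp,
    HClass.pre_id, HClass.add_assoc c₅ c₆,
    HClass.add_assoc (by rw [HClass.src_add c₆]; exact c₅) (by rw [HClass.tgt_add c₆]; exact c₇),
    HClass.add_assoc c₆ c₇, ← HClass.pre_add _ (by simp [hη₁, hχt]), e,
    ← HClass.pre_add _ (by rw [HClass.src_add (by simp [hs, hθ₁])]; simp),
    HClass.add_rev_cancel (by simp [hs, hθ₁])]
  have i := HClass.null_post_add (a := HClass.mk K.κ) n₁ (HClass.mk θ)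
  rw [HClass.src_mk, HClass.tgt_mk, HClass.tgt_mk, hθ₁, hθ₂, HClass.post_id, n₂,
    HClass.pre_comp] at i
  exact i

/-- The map of h-kernels induced by a square commuting up to homotopy, with vertical maps homotopy
equivalences, is a homotopy equivalence. -/
theorem HKernel.isHomotopyEquiv_of_square {A B A' B' : C} {g : A ⟶ B} {g' : A' ⟶ B'}
    (K : HKernel g) (K' : HKernel g') {a : A ⟶ A'} {b : B ⟶ B'} (ha : IsHomotopyEquiv a)
    (hb : IsHomotopyEquiv b) {ψ : Htpy A B'} (hs : src ψ = g ≫ b) (ht : tgt ψ = a ≫ g')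
    {t : K.K ⟶ K'.K} (h₁ : t ≫ K'.k = K.k ≫ a)
    (h₂ : Rel₂ (pre t K'.κ) (concat (post K.κ b) (pre K.k ψ)
      (by rw [tgt_post, src_pre, K.null.2, hs, Category.assoc]))) :
    IsHomotopyEquiv t := by
  rw [← HClass.mk_eq_mk, ← HClass.mk_add_mk] at h₂
  obtain ⟨a', b', χ, t', ha', hb', hχs, hχt, h₁', h₂', h⟩ :=
    K.exists_retraction K' ha hb (ψ := HClass.mk ψ) hs ht h₁ h₂
  obtain ⟨-, -, -, t'', -, -, -, -, -, -, h'⟩ :=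
    K'.exists_retraction K ha' hb' hχs hχt h₁' h₂'
  exact IsHomotopyEquiv.of_retractions h h'

end Pointed

end HomotopyStructure

namespace HomotopyStructure

/-! ### Duality: the homotopical structure on the opposite category. -/

section Opposite

variable {C : Type u} [Category.{v} C]

instance opposite [HomotopyStructure.{w} C] : HomotopyStructure.{w} Cᵒᵖ where
  Htpy X Y := Htpy Y.unop X.unop
  src α := (src α).op
  tgt α := (tgt α).op
  pre p α := post α p.unop
  post α q := pre q.unop α
  src_pre p α := congrArg Quiver.Hom.op (src_post α p.unop)
  tgt_pre p α := congrArg Quiver.Hom.op (tgt_post α p.unop)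
  src_post α q := congrArg Quiver.Hom.op (src_pre q.unop α)
  tgt_post α q := congrArg Quiver.Hom.op (tgt_pre q.unop α)
  pre_id α := post_id α
  post_id α := pre_id α
  pre_comp p q α := post_comp α q.unop p.unop
  post_comp α p q := pre_comp q.unop p.unop α
  post_pre p α q := (post_pre q.unop α p.unop).symm
  triv f := triv f.unop
  src_triv f := congrArg Quiver.Hom.op (src_triv f.unop)
  tgt_triv f := congrArg Quiver.Hom.op (tgt_triv f.unop)
  pre_triv p f := post_triv f.unop p.unop
  post_triv f q := pre_triv q.unop f.unop
  rev α := rev α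
  src_rev α := congrArg Quiver.Hom.op (src_rev α)
  tgt_rev α := congrArg Quiver.Hom.op (tgt_rev α)
  pre_rev p α := post_rev α p.unop
  post_rev α q := pre_rev q.unop α
  concat α β h := concat α β (congrArg Quiver.Hom.unop h)
  src_concat α β h := congrArg Quiver.Hom.op (src_concat α β (congrArg Quiver.Hom.unop h))
  tgt_concat α β h := congrArg Quiver.Hom.op (tgt_concat α β (congrArg Quiver.Hom.unop h))
  pre_concat p α β h := post_concat α β (congrArg Quiver.Hom.unop h) p.unop
  post_concat α β h q := pre_concat q.unop α β (congrArg Quiver.Hom.unop h)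
  Rel₂ α β := Rel₂ α β
  rel_src h := congrArg Quiver.Hom.op (rel_src h)
  rel_tgt h := congrArg Quiver.Hom.op (rel_tgt h)
  rel_equiv X Y := rel_equiv Y.unop X.unop
  rel_pre p _ _ h := rel_post p.unop h
  rel_post q h := rel_pre q.unop h
  rel_rev h := rel_rev h
  rel_concat _ _ h₁ h₂ := rel_concat _ _ h₁ h₂
  triv_concat α := triv_concat α
  concat_triv α := concat_triv α
  concat_rev α := concat_rev α
  rev_concat α := rev_concat α
  concat_assoc α β δ h h' :=
    concat_assoc α β δ (congrArg Quiver.Hom.unop h) (congrArg Quiver.Hom.unop h')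
  -- Reversing composition swaps the two sides of the interchange law.
  interchange α β := (rel_equiv _ _).symm (interchange β α)

theorem homotopic_op_iff [HomotopyStructure.{w} C] {X Y : C} {f g : X ⟶ Y} :
    Homotopic f.op g.op ↔ Homotopic f g :=
  ⟨fun ⟨α, h₁, h₂⟩ => ⟨α, congrArg Quiver.Hom.unop h₁, congrArg Quiver.Hom.unop h₂⟩,
    fun ⟨α, h₁, h₂⟩ => ⟨α, congrArg Quiver.Hom.op h₁, congrArg Quiver.Hom.op h₂⟩⟩

theorem isHomotopyEquiv_op_iff [HomotopyStructure.{w} C] {X Y : C} {f : X ⟶ Y} :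
    IsHomotopyEquiv f.op ↔ IsHomotopyEquiv f :=
  ⟨fun ⟨g, h₁, h₂⟩ => ⟨g.unop, homotopic_op_iff.1 h₂, homotopic_op_iff.1 h₁⟩,
    fun ⟨g, h₁, h₂⟩ => ⟨g.op, homotopic_op_iff.2 h₂, homotopic_op_iff.2 h₁⟩⟩

variable [HasZeroMorphisms C]

theorem isNull_op_iff [HomotopyStructure.{w} C] {X Y : C} {ξ : Htpy X Y} {h : X ⟶ Y} :
    IsNull (C := Cᵒᵖ) (X := .op Y) (Y := .op X) ξ h.op ↔ IsNull ξ h :=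
  ⟨fun ⟨h₁, h₂⟩ => ⟨congrArg Quiver.Hom.unop h₁, congrArg Quiver.Hom.unop h₂⟩,
    fun ⟨h₁, h₂⟩ => ⟨congrArg Quiver.Hom.op h₁, congrArg Quiver.Hom.op h₂⟩⟩

/-- An h-cokernel in `C` is an h-kernel in `Cᵒᵖ`. -/
def HCokernel.op [HomotopyStructure.{w} C] {A B : C} {f : A ⟶ B} (K : HCokernel f) :
    HKernel f.op where
  K := .op K.Q
  k := K.c.op
  κ := K.γ
  null := isNull_op_iff.2 K.null
  univ x ξ h := by
    obtain ⟨t, ⟨h₁, h₂⟩, ht⟩ := K.univ x.unop ξ (isNull_op_iff.1 h)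
    exact ⟨t.op, ⟨congrArg Quiver.Hom.op h₁, h₂⟩, fun s hs =>
      congrArg Quiver.Hom.op (ht s.unop ⟨congrArg Quiver.Hom.unop hs.1, hs.2⟩)⟩
  univ₂ a b θ hs ht h := by
    obtain ⟨φ, h₁, h₂, h₃⟩ := K.univ₂ a.unop b.unop θ (congrArg Quiver.Hom.unop hs)
      (congrArg Quiver.Hom.unop ht) h
    exact ⟨φ, congrArg Quiver.Hom.op h₁, congrArg Quiver.Hom.op h₂, h₃⟩

/-- An h-kernel in `C` is an h-cokernel in `Cᵒᵖ`. -/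
def HKernel.op [HomotopyStructure.{w} C] {A B : C} {f : A ⟶ B} (K : HKernel f) :
    HCokernel f.op where
  Q := .op K.K
  c := K.k.op
  γ := K.κ
  null := isNull_op_iff.2 K.null
  univ x ξ h := by
    obtain ⟨t, ⟨h₁, h₂⟩, ht⟩ := K.univ x.unop ξ (isNull_op_iff.1 h)
    exact ⟨t.op, ⟨congrArg Quiver.Hom.op h₁, h₂⟩, fun s hs =>
      congrArg Quiver.Hom.op (ht s.unop ⟨congrArg Quiver.Hom.unop hs.1, hs.2⟩)⟩
  univ₂ a b θ hs ht h := by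
    obtain ⟨φ, h₁, h₂, h₃⟩ := K.univ₂ a.unop b.unop θ (congrArg Quiver.Hom.unop hs)
      (congrArg Quiver.Hom.unop ht) h
    exact ⟨φ, congrArg Quiver.Hom.op h₁, congrArg Quiver.Hom.op h₂, h₃⟩

end Opposite

variable {C : Type u} [Category.{v} C] [HasZeroMorphisms C] [HasZeroObject C]
  [PointedHomotopicalCategory.{w} C]

instance oppositePointed : PointedHomotopicalCategory.{w} Cᵒᵖ where
  htpy_to_zero hZ α := htpy_from_zero hZ.unop α
  htpy_from_zero hZ α := htpy_to_zero hZ.unop α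
  hker f := (hcok f.unop).op
  hcok f := (hker f.unop).op

/-- The map of h-cokernels induced by a square commuting up to homotopy, with vertical maps
homotopy equivalences, is a homotopy equivalence. -/
theorem HCokernel.isHomotopyEquiv_of_square {A B A' B' : C} {f : A ⟶ B} {f' : A' ⟶ B'}
    (K : HCokernel f) (K' : HCokernel f') {a : A ⟶ A'} {b : B ⟶ B'} (ha : IsHomotopyEquiv a)
    (hb : IsHomotopyEquiv b) {ψ : Htpy A B'} (hs : src ψ = a ≫ f') (ht : tgt ψ = f ≫ b)
    {t : K.Q ⟶ K'.Q} (h₁ : K.c ≫ t = b ≫ K'.c)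
    (h₂ : Rel₂ (post K.γ t) (concat (pre a K'.γ) (post ψ K'.c)
      (by rw [tgt_pre, src_post, K'.null.2, hs, Category.assoc]))) :
    IsHomotopyEquiv t :=
  -- In `Cᵒᵖ` the induced map goes from `K'` to `K`, with `a` and `b` exchanged; this is why `ψ` is
  -- directed opposite to the kernel case.
  isHomotopyEquiv_op_iff.1 <| HKernel.isHomotopyEquiv_of_square (C := Cᵒᵖ) K'.op K.op
    (isHomotopyEquiv_op_iff.2 hb) (isHomotopyEquiv_op_iff.2 ha) (ψ := ψ)
    (congrArg Quiver.Hom.op hs) (congrArg Quiver.Hom.op ht) (t := t.op)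
    (congrArg Quiver.Hom.op h₁) h₂

end HomotopyStructure

/-! ### Dual sequences and their comparison maps. -/

namespace HDiffSeq

variable {C : Type u} [Category.{v} C] [HasZeroMorphisms C] [HasZeroObject C]
  [PointedHomotopicalCategory.{w} C]

/-- The dual sequence `(g, f; α)` in `Cᵒᵖ`. -/
def op (S : HDiffSeq.{w} C) : HDiffSeq.{w} Cᵒᵖ :=
  ⟨S.g.op, S.f.op, S.α, isNull_op_iff.2 S.null⟩

theorem uα_op (S : HDiffSeq.{w} C) : S.op.uα = S.vα.op := by
  refine HKernel.hom_ext _ ((HKernel.lift_k _ _ _ _).trans ?_) ((HKernel.lift_κ _ _ _ _).trans ?_)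
  · exact congrArg Quiver.Hom.op (HCokernel.c_desc _ _ _ S.null).symm
  · exact (HCokernel.γ_desc _ _ _ S.null).symm

theorem vα_op (S : HDiffSeq.{w} C) : S.op.vα = S.uα.op := by
  refine HCokernel.hom_ext _ ((HCokernel.c_desc _ _ _ _).trans ?_)
    ((HCokernel.γ_desc _ _ _ _).trans ?_)
  · exact congrArg Quiver.Hom.op (HKernel.lift_k _ _ _ S.null).symm
  · exact (HKernel.lift_κ _ _ _ S.null).symm

theorem c_vMap (S : HDiffSeq.{w} C) : (hcok S.f).c ≫ S.vMap = (hcok (hker S.g).k).c :=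
  HCokernel.c_desc _ _ _ _

theorem γ_vMap (S : HDiffSeq.{w} C) :
    post (hcok S.f).γ S.vMap = pre S.uα (hcok (hker S.g).k).γ :=
  HCokernel.γ_desc _ _ _ _

theorem uMap_op (S : HDiffSeq.{w} C) : S.op.uMap = S.vMap.op := by
  refine HKernel.hom_ext _ ((HKernel.lift_k _ _ _ _).trans ?_) ((HKernel.lift_κ _ _ _ _).trans ?_)
  · exact congrArg Quiver.Hom.op S.c_vMap.symm
  · rw [vα_op]
    exact S.γ_vMap.symm

theorem isHomotopyEquiv_uα_op_iff (S : HDiffSeq.{w} C) :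
    IsHomotopyEquiv S.op.uα ↔ IsHomotopyEquiv S.vα := by
  rw [uα_op]
  exact isHomotopyEquiv_op_iff

theorem isHomotopyEquiv_uMap_op_iff (S : HDiffSeq.{w} C) :
    IsHomotopyEquiv S.op.uMap ↔ IsHomotopyEquiv S.vMap := by
  rw [uMap_op]
  exact isHomotopyEquiv_op_iff

/-- The vertical maps change direction, so the squares swap places and their homotopies are
reversed; the coherence condition then becomes itself with its sides exchanged. -/
theorem Equivalent.op {S T : HDiffSeq.{w} C} (h : S.Equivalent T) : T.op.Equivalent S.op := by
  obtain ⟨u₁, u₀, u₂, φ, ψ, hφs, hφt, hψs, hψt, h₁, h₀, h₂, h⟩ := h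
  refine ⟨u₂.op, u₀.op, u₁.op, rev ψ, rev φ, ?_, ?_, ?_, ?_, isHomotopyEquiv_op_iff.2 h₂,
    isHomotopyEquiv_op_iff.2 h₀, isHomotopyEquiv_op_iff.2 h₁, ?_⟩
  · exact congrArg Quiver.Hom.op ((src_rev ψ).trans hψt)
  · exact congrArg Quiver.Hom.op ((tgt_rev ψ).trans hψs)
  · exact congrArg Quiver.Hom.op ((src_rev φ).trans hφt)
  · exact congrArg Quiver.Hom.op ((tgt_rev φ).trans hφs)
  · have e : Rel₂ (concat (post S.α u₂) (rev (pre S.f (rev ψ))) (by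
          rw [tgt_post, src_rev, tgt_pre, tgt_rev, hψs, S.null.2, Category.assoc]))
        (concat (pre u₁ T.α) (post (rev φ) T.g) (by
          rw [tgt_pre, src_post, src_rev, hφt, T.null.2, Category.assoc])) := by
      rw [← HClass.mk_eq_mk, ← HClass.mk_add_mk, ← HClass.mk_add_mk] at h ⊢
      simp only [HClass.mk_pre, HClass.mk_post, HClass.mk_rev, HClass.pre_rev, HClass.post_rev,
        HClass.rev_rev] at h ⊢
      exact h.symm
    exact e

end HDiffSeq

/-! ### Invariance of the exactness properties under equivalence. -/

namespace HDiffSeq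

variable {C : Type u} [Category.{v} C] [HasZeroMorphisms C] [HasZeroObject C]
  [PointedHomotopicalCategory.{w} C]

theorem uα_k (S : HDiffSeq.{w} C) : S.uα ≫ (hker S.g).k = S.f := HKernel.lift_k _ _ _ _

theorem uα_κ (S : HDiffSeq.{w} C) : pre S.uα (hker S.g).κ = S.α := HKernel.lift_κ _ _ _ _

theorem c_vα (S : HDiffSeq.{w} C) : (hcok S.f).c ≫ S.vα = S.g := HCokernel.c_desc _ _ _ _

theorem γ_vα (S : HDiffSeq.{w} C) : post (hcok S.f).γ S.vα = S.α := HCokernel.γ_desc _ _ _ _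

theorem Equivalent.leftHExact_iff {S T : HDiffSeq.{w} C} (h : S.Equivalent T) :
    S.LeftHExact ↔ T.LeftHExact := by
  obtain ⟨u₁, u₀, u₂, φ, ψ, hφs, hφt, hψs, hψt, h₁, h₀, h₂, h⟩ := h
  have n := (hker S.g).null
  let ξ := concat (post (hker S.g).κ u₂) (pre (hker S.g).k ψ)
    (by rw [tgt_post, src_pre, n.2, hψs, Category.assoc])
  have hξ : IsNull ξ (((hker S.g).k ≫ u₀) ≫ T.g) :=
    ⟨by simp [ξ, n.1], by simp [ξ, hψt]⟩
  have ht := (hker T.g).lift_k _ ξ hξ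
  have ht' := (hker T.g).lift_κ _ ξ hξ
  set t := (hker T.g).lift _ ξ hξ
  have hte : IsHomotopyEquiv t :=
    HKernel.isHomotopyEquiv_of_square _ _ h₀ h₂ hψs hψt ht (ht' ▸ (rel_equiv _ _).refl _)
  refine isHomotopyEquiv_iff_of_square ?_ h₁ hte
  -- The lifting condition for `φ` is the coherence condition with `post φ T.g` moved to the other
  -- side.
  refine HKernel.homotopic _ (θ := HClass.mk φ) ?_ ?_ ?_
  · rw [Category.assoc, ht, ← Category.assoc, uα_k]; exact hφs
  · rw [Category.assoc, uα_k]; exact hφt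
  · rw [← HClass.mk_pre, ← HClass.mk_pre, pre_comp, pre_comp, ht', uα_κ, pre_concat, ← HClass.mk_add_mk,
      ← post_pre, uα_κ, ← pre_comp, uα_k]
    rw [← HClass.mk_eq_mk, ← HClass.mk_add_mk, ← HClass.mk_add_mk] at h
    rw [← h, HClass.mk_rev, HClass.mk_post,
      HClass.add_rev_add_cancel (by simp [T.null.2, hφt])]

theorem Equivalent.rightHExact_iff {S T : HDiffSeq.{w} C} (h : S.Equivalent T) :
    S.RightHExact ↔ T.RightHExact :=
  S.isHomotopyEquiv_uα_op_iff.symm.trans <|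
    h.op.leftHExact_iff.symm.trans T.isHomotopyEquiv_uα_op_iff

/-- An equivalence of sequences whose first square commutes strictly. -/
theorem Equivalent.of_comm {S T : HDiffSeq.{w} C} {u₁ : S.X ⟶ T.X} {u₀ : S.A ⟶ T.A}
    {u₂ : S.Y ⟶ T.Y} (h₁ : IsHomotopyEquiv u₁) (h₀ : IsHomotopyEquiv u₀)
    (h₂ : IsHomotopyEquiv u₂) (comm : u₁ ≫ T.f = S.f ≫ u₀) {ψ : HClass S.A T.Y}
    (hs : ψ.src = S.g ≫ u₂) (ht : ψ.tgt = u₀ ≫ T.g)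
    (h : HClass.pre u₁ (HClass.mk T.α) = HClass.post (HClass.mk S.α) u₂ + HClass.pre S.f ψ) :
    S.Equivalent T := by
  obtain ⟨ψ, rfl⟩ := HClass.mk_surjective ψ
  refine ⟨u₁, u₀, u₂, triv (S.f ≫ u₀), ψ, src_triv _, (tgt_triv _).trans comm.symm, hs, ht,
    h₁, h₀, h₂, ?_⟩
  rw [← HClass.mk_eq_mk, ← HClass.mk_add_mk, ← HClass.mk_add_mk, HClass.mk_pre, HClass.mk_post,
    HClass.mk_pre, ← h, post_triv, HClass.mk_rev]
  refine (congrArg _ (HClass.rev_triv _)).trans (HClass.add_triv ?_)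
  rw [HClass.tgt_pre, HClass.tgt_mk, T.null.2, ← Category.assoc, comm]

/-- The sequence `(kcf, g; v_α.κcf)`, whose comparison with the h-kernel of `g` is `uMap`. -/
noncomputable def imageSeq (S : HDiffSeq.{w} C) : HDiffSeq.{w} C :=
  ⟨(hker (hcok S.f).c).k, S.g, post (hker (hcok S.f).c).κ S.vα,
    by rw [src_post, (hker (hcok S.f).c).null.1, zero_comp],
    by rw [tgt_post, (hker (hcok S.f).c).null.2, Category.assoc, c_vα]⟩

theorem Equivalent.imageSeq {S T : HDiffSeq.{w} C} (h : S.Equivalent T) :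
    S.imageSeq.Equivalent T.imageSeq := by
  obtain ⟨u₁, u₀, u₂, φ, ψ, hφs, hφt, hψs, hψt, h₁, h₀, h₂, h⟩ := h
  have nT := (hcok T.f).null
  have mS := (hker (hcok S.f).c).null
  -- the induced map of h-cokernels
  let ζ := concat (pre u₁ (hcok T.f).γ) (post (rev φ) (hcok T.f).c)
    (by rw [tgt_pre, src_post, nT.2, src_rev, hφt, Category.assoc])
  have hζ : IsNull ζ (S.f ≫ u₀ ≫ (hcok T.f).c) :=
    ⟨by simp [ζ, nT.1], by simp [ζ, hφs]⟩
  have hz := (hcok S.f).c_desc _ ζ hζ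
  have hz' := (hcok S.f).γ_desc _ ζ hζ
  set z := (hcok S.f).desc _ ζ hζ
  have hze : IsHomotopyEquiv z :=
    HCokernel.isHomotopyEquiv_of_square _ _ h₁ h₀ (ψ := rev φ) (by simp [hφt]) (by simp [hφs]) hz
      (by rw [hz']; exact (rel_equiv _ _).refl _)
  -- the induced map of their h-kernels
  have hξ : IsNull (post (hker (hcok S.f).c).κ z) (((hker (hcok S.f).c).k ≫ u₀) ≫ (hcok T.f).c) :=
    ⟨by simp [mS.1], by simp [mS.2, hz]⟩
  have ht := (hker (hcok T.f).c).lift_k _ _ hξ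
  have ht' := (hker (hcok T.f).c).lift_κ _ _ hξ
  set t := (hker (hcok T.f).c).lift _ _ hξ
  have hte : IsHomotopyEquiv t := by
    refine HKernel.isHomotopyEquiv_of_square _ _ h₀ hze (ψ := triv ((hcok S.f).c ≫ z))
      (src_triv _) (by rw [tgt_triv, hz]) ht ?_
    rw [← HClass.mk_eq_mk, ← HClass.mk_add_mk, ht', pre_triv]
    exact (HClass.add_triv (by simp [mS.2])).symm
  -- the extension of `ψ` to the h-cokernels
  rw [← HClass.mk_eq_mk, ← HClass.mk_add_mk, ← HClass.mk_add_mk] at h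
  -- Because `z` was built from `rev φ`, the condition for extending `ψ` along `(hcok S.f).c` is the
  -- coherence condition `h`.
  obtain ⟨χ, hχs, hχt, hχ⟩ := (hcok S.f).exists_htpy (a := S.vα ≫ u₂) (b := z ≫ T.vα)
    (θ := HClass.mk ψ) (by rw [← Category.assoc, c_vα]; exact hψs)
    (by rw [← Category.assoc, hz, Category.assoc, c_vα]; exact hψt)
    (by
      rw [← HClass.mk_post, ← HClass.mk_post, ← HClass.mk_pre, post_comp, γ_vα, ← h, post_comp,
        hz', post_concat, ← HClass.mk_add_mk, post_pre, γ_vα, ← post_comp, c_vα, post_rev])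
  refine .of_comm (S := S.imageSeq) (T := T.imageSeq) hte h₀ h₂ ht (ψ := HClass.mk ψ) hψs hψt ?_
  -- Interchange of the nullhomotopy of the h-kernel with `χ` is the coherence condition for the
  -- image sequences, since `χ` restricts to `ψ`.
  have i := HClass.null_post_add (a := HClass.mk (hker (hcok S.f).c).κ) mS.1 χ
  rw [HClass.tgt_mk, mS.2, hχs, hχt, HClass.pre_comp, hχ, HClass.post_comp, HClass.post_comp,
    ← HClass.mk_post _ z, ← ht', HClass.mk_pre, HClass.post_pre] at i
  exact i.symm

/-- `S.imageSeq.uα` is `S.uMap` by definition, so left h-exactness of `S.imageSeq` is the property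
in question. -/
theorem Equivalent.isHomotopyEquiv_uMap_iff {S T : HDiffSeq.{w} C} (h : S.Equivalent T) :
    IsHomotopyEquiv S.uMap ↔ IsHomotopyEquiv T.uMap :=
  h.imageSeq.leftHExact_iff

theorem Equivalent.isHomotopyEquiv_vMap_iff {S T : HDiffSeq.{w} C} (h : S.Equivalent T) :
    IsHomotopyEquiv S.vMap ↔ IsHomotopyEquiv T.vMap :=
  S.isHomotopyEquiv_uMap_op_iff.symm.trans <|
    h.op.isHomotopyEquiv_uMap_iff.symm.trans T.isHomotopyEquiv_uMap_op_iff

theorem leftHExact_kernelSeq {A Y : C} (g : A ⟶ Y) : (kernelSeq.{w} g).LeftHExact := by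
  have : (kernelSeq.{w} g).uα = 𝟙 (hker g).K :=
    HKernel.hom_ext _ ((uα_k _).trans (Category.id_comp _).symm)
      ((uα_κ _).trans (pre_id _).symm)
  rw [LeftHExact, this]
  exact IsHomotopyEquiv.id _

theorem LeftHExact.equivalent_kernelSeq {S : HDiffSeq.{w} C} (h : S.LeftHExact) :
    S.Equivalent (kernelSeq S.g) := by
  refine .of_comm (T := kernelSeq S.g) h (.id _) (.id _) (S.uα_k.trans (Category.comp_id _).symm)
    (ψ := HClass.triv S.g) ((HClass.src_triv _).trans (Category.comp_id _).symm)
    ((HClass.tgt_triv _).trans (Category.id_comp _).symm) ?_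
  have e : HClass.post (HClass.mk S.α) (𝟙 S.Y) + HClass.pre S.f (HClass.triv S.g) =
      HClass.mk S.α := by
    rw [HClass.post_id, HClass.pre_triv, HClass.add_triv (by simpa using S.null.2)]
  exact (congrArg HClass.mk S.uα_κ).trans e.symm

end HDiffSeq

theorem mainTheorem8 {C : Type u} [Category.{v} C] [HasZeroMorphisms C] [HasZeroObject C]
    [PointedHomotopicalCategory.{w} C] :
    (∀ S T : HDiffSeq.{w} C, S.Equivalent T →
      (S.LeftHExact ↔ T.LeftHExact) ∧
      (S.RightHExact ↔ T.RightHExact) ∧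
      (S.StronglyHExact ↔ T.StronglyHExact) ∧
      (S.HExact ↔ T.HExact)) ∧
    (∀ S : HDiffSeq.{w} C, S.LeftHExact ↔ S.Equivalent (HDiffSeq.kernelSeq S.g)) := by
  refine ⟨fun S T h => ⟨h.leftHExact_iff, h.rightHExact_iff,
    and_congr h.leftHExact_iff h.rightHExact_iff,
    and_congr h.isHomotopyEquiv_uMap_iff h.isHomotopyEquiv_vMap_iff⟩, fun S =>
    ⟨fun h => h.equivalent_kernelSeq, fun h => ?_⟩⟩
  exact h.leftHExact_iff.2 (HDiffSeq.leftHExact_kernelSeq S.g)
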